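/- For $\eta>0$, a differentiable function $f:\mathbb{R}\to\mathbb{R}$ and $x_0\in\mathbb{R}$, let $\mathrm{NAG}(f,x_0,t,\eta)=(x_t,y_t)$ denote the iterates of Nesterov's accelerated gradient method: $y_0=x_0$ and, for $t\ge 1$, $$x_t=y_{t-1}-\eta\nabla f(y_{t-1}),\qquad y_t=x_t+\gamma_t(x_t-x_{t-1}),\qquad \gamma_t=\frac{t-1}{t+2}.$$ For $\epsilon>0$, let $$\delta_t(x_0,\epsilon)=\sup\{\,|\tilde x_t-x_t| : \tilde x_0\in\mathbb{R},\ |\tilde x_0-x_0|\le\epsilon\,\}$$ be the initialization stability at $x_0$ of $t$-step NAG on $f$ with step size $\eta$, where $x_t$ and $\tilde x_t$ are the $x$-iterates at step $t$ started at $x_0$ and $\tilde x_0$. A function is $\beta$-smooth if it is differentiable and its gradient is $\beta$-Lipschitz. **Theorem (initialization stability lower bound for NAG).** There are universal constants $c_1,c_2>0$ such that the following holds. Let $\epsilon,G,\beta>0$ and $0<\eta\le 1/\beta$, and consider the initialization points $x_0=0$ and $\tilde x_0=\epsilon$. Then there exists a convex, $\beta$-smooth, $G$-Lipschitz function $f:\mathbb{R}\to\mathbb{R}$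 that attains a minimum over $\mathbb{R}$, such that the sequences $(x_t,y_t)=\mathrm{NAG}(f,x_0,t,\eta)$ and $(\tilde x_t,\tilde y_t)=\mathrm{NAG}(f,\tilde x_0,t,\eta)$ satisfy $$\delta_t(x_0,\epsilon)\ \ge\ |x_t-\tilde x_t|\ \ge\ \min\Bigl\{\frac{G}{3\beta},\ c_2e^{c_1\eta\beta t}\,\epsilon\Bigr\}\qquad\text{for all } t\in\Bigl\{\Bigl\lceil\frac{10}{\eta\beta}\Bigr\rceil(i+2) : i=1,2,\ldots\Bigr\}.$$ Furthermore, for the same $f$ and every integer $t\ge 0$ with $t>\bigl\lceil\frac{10}{\eta\beta}\bigr\rceil\bigl(\ln\frac{3G}{2\beta\epsilon}+3\bigr)$, $$\delta_t(x_0,\epsilon)\ \ge\ \frac{G}{3\beta}.$$ -/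

import Mathlib

section NAG

variable {E : Type*} [NormedAddCommGroup E] [InnerProductSpace ℝ E] [CompleteSpace E]

/-- `f` is `β`-smooth: it is differentiable and its gradient is `β`-Lipschitz. -/
def IsSmooth (β : ℝ) (f : E → ℝ) : Prop :=
  Differentiable ℝ f ∧ ∀ u v : E, ‖gradient f u - gradient f v‖ ≤ β * ‖u - v‖

/-- The momentum coefficients `γ_t = (t - 1) / (t + 2)`, computed in `ℝ`. -/
noncomputable def nagGamma (t : ℕ) : ℝ := ((t : ℝ) - 1) / ((t : ℝ) + 2)

/-- The pair of iterates `(x_t, y_t)` of Nesterov's accelerated gradient method on `f`,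
initialized at `x₀`, with step size `η`: `y_0 = x_0` and, for `t ≥ 1`,
`x_t = y_{t-1} - η ∇f(y_{t-1})` and `y_t = x_t + γ_t (x_t - x_{t-1})`. -/
noncomputable def nag (f : E → ℝ) (x₀ : E) (η : ℝ) : ℕ → E × E
  | 0 => (x₀, x₀)
  | t + 1 =>
    let p := nag f x₀ η t
    let x := p.2 - η • gradient f p.2
    (x, x + nagGamma (t + 1) • (x - p.1))

/-- The output `x_t` of `t` steps of NAG. -/
noncomputable def nagX (f : E → ℝ) (η : ℝ) (t : ℕ) (x₀ : E) : E := (nag f x₀ η t).1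

/-- The initialization stability at `x₀` of an algorithm with output `A x` when initialized
at `x`: the supremum, in the extended reals, of `‖A x - A x₀‖` over `‖x - x₀‖ ≤ ε`. -/
noncomputable def initStability (A : E → E) (x₀ : E) (ε : ℝ) : EReal :=
  ⨆ x : {x : E // ‖x - x₀‖ ≤ ε}, ((‖A x - A x₀‖ : ℝ) : EReal)

end NAG

/-! In dimension one the difference of two runs obeys a linear recursion whose only input is `κ t`,
the step size times the average curvature between the two `y`-iterates. A single kick of curvature
`β` at time `s` gives the difference a velocity of about `-ηβ` times its size. With no curvature
afterwards, momentum keeps it moving for `T ≈ 10 / (ηβ)` steps, so it crosses zero and comes out at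
least three times as large (`linNag_period`). One kick every `T` steps yields growth `3 ^ i`.

To realise the kicks by a convex function, the gradient is built from ramps of slope `β`, the one
for time `s` spanning exactly the gap between the two runs at that time. Until then this ramp alone
contributes `-β` times its width to both gradients, so both runs have gained enough speed to meet it
at time `s` only (`drivenNag_snd_long_steps`). The gaps come from the linear recursion alone, hence
the gradients can be prescribed before the function exists (`exists_nag_sub_nag_eq_linNag`).

The Lipschitz bound limits the total width of the ramps. The kicks therefore stop once the
difference reaches `G / (3β)`, after which it never shrinks (`exists_linNag_growth`). -/

/-- The pair `(d_t, e_t)` of iterates of the linear recursion followed by the difference of two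
runs of NAG, where `κ t` is the step size times the average curvature met at step `t`. -/
noncomputable def linNag (κ : ℕ → ℝ) (ε : ℝ) : ℕ → ℝ × ℝ
  | 0 => (ε, ε)
  | t + 1 =>
    let p := linNag κ ε t
    let d := (1 - κ t) * p.2
    (d, d + nagGamma (t + 1) * (d - p.1))

/-- The pair `(x_t, y_t)` of iterates of NAG when the negated gradient at step `t` is `g t`. -/
noncomputable def drivenNag (g : ℕ → ℝ) (x₀ η : ℝ) : ℕ → ℝ × ℝ
  | 0 => (x₀, x₀)
  | t + 1 =>
    let p := drivenNag g x₀ η t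
    let x := p.2 + η * g t
    (x, x + nagGamma (t + 1) * (x - p.1))

theorem nagGamma_succ (t : ℕ) : nagGamma (t + 1) = (t : ℝ) / ((t : ℝ) + 3) := by
  unfold nagGamma; push_cast; ring

theorem nagGamma_succ_nonneg (t : ℕ) : 0 ≤ nagGamma (t + 1) := by
  rw [nagGamma_succ]; positivity

theorem nagGamma_succ_le_one (t : ℕ) : nagGamma (t + 1) ≤ 1 := by
  rw [nagGamma_succ, div_le_one (by positivity)]; linarith

/-! ### Growth of the difference under isolated kicks of curvature -/

section linNag

variable {κ : ℕ → ℝ} {ε : ℝ}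

theorem linNag_succ_fst (t : ℕ) :
    (linNag κ ε (t + 1)).1 = (1 - κ t) * (linNag κ ε t).2 := rfl

theorem linNag_succ_snd (t : ℕ) :
    (linNag κ ε (t + 1)).2 = (linNag κ ε (t + 1)).1 +
      nagGamma (t + 1) * ((linNag κ ε (t + 1)).1 - (linNag κ ε t).1) := rfl

theorem linNag_congr {κ' : ℕ → ℝ} {n : ℕ} (h : ∀ t < n, κ t = κ' t) :
    ∀ t ≤ n, linNag κ ε t = linNag κ' ε t := by
  intro t
  induction t with
  | zero => intro _; rfl
  | succ t ih =>
    intro ht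
    simp only [linNag, ih (by omega), h t (by omega)]

theorem linNag_eq_of_forall_eq_zero {n : ℕ} (h : ∀ t < n, κ t = 0) :
    ∀ t ≤ n, linNag κ ε t = (ε, ε) := by
  intro t
  induction t with
  | zero => intro _; rfl
  | succ t ih =>
    intro ht
    simp [linNag, ih (by omega), h t (by omega)]

/-- While no curvature is met, the difference moves along a fixed direction with a speed that
decays like the product of the momentum coefficients. -/
theorem linNag_coast {s : ℕ} (hs : 1 ≤ s) (n : ℕ) (h : ∀ i, s < i → i ≤ s + n → κ i = 0) :
    (linNag κ ε (s + n + 1)).1 - (linNag κ ε (s + n)).1 =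
        ((linNag κ ε (s + 1)).1 - (linNag κ ε s).1) *
          (s * (s + 1) * (s + 2) / ((s + n) * (s + n + 1) * (s + n + 2))) ∧
      (linNag κ ε (s + n + 1)).1 = (linNag κ ε s).1 +
        ((linNag κ ε (s + 1)).1 - (linNag κ ε s).1) *
          ((s + 2) / 2 * (1 - s * (s + 1) / ((s + n + 1) * (s + n + 2)))) := by
  have hs' : (1 : ℝ) ≤ s := by exact_mod_cast hs
  have hs0 : (s : ℝ) ≠ 0 := by positivity
  induction n with
  | zero =>
    have h1 : (s : ℝ) + 1 ≠ 0 := by positivity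
    have h2 : (s : ℝ) + 2 ≠ 0 := by positivity
    refine ⟨?_, ?_⟩
    · simp only [add_zero, Nat.cast_zero]
      field_simp
    · simp only [add_zero, Nat.cast_zero]
      field_simp
      ring
  | succ n ih =>
    obtain ⟨ih1, ih2⟩ := ih fun i h1 h2 => h i h1 (by omega)
    have hn : (0 : ℝ) ≤ n := by positivity
    set U := (linNag κ ε (s + 1)).1 - (linNag κ ε s).1
    -- The product of the factors `s / (s + 3)`, `(s + 1) / (s + 4)`, … telescopes; so does the sum
    -- of the resulting velocities.
    have key : (linNag κ ε (s + (n + 1) + 1)).1 - (linNag κ ε (s + (n + 1))).1 =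
        U * (s * (s + 1) * (s + 2) /
          ((s + (n + 1 : ℕ)) * (s + (n + 1 : ℕ) + 1) * (s + (n + 1 : ℕ) + 2))) := by
      rw [linNag_succ_fst, h (s + (n + 1)) (by omega) le_rfl, ← add_assoc, linNag_succ_snd, ih1,
        nagGamma_succ]
      push_cast
      field_simp
      ring
    refine ⟨key, ?_⟩
    rw [← sub_add_cancel (linNag κ ε (s + (n + 1) + 1)).1 (linNag κ ε (s + (n + 1))).1, key,
      ← add_assoc, ih2]
    push_cast
    field_simp
    ring

/-- The coefficients of `linNag_coast` over a period of `m + 1` steps that begins at time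
`s ≥ 2 (m + 1)`. -/
theorem linNag_coast_coeff_bounds {s m : ℝ} (hm : 0 ≤ m) (hs : 2 * (m + 1) ≤ s) :
    0 ≤ s * (s + 1) * (s + 2) / ((s + m) * (s + m + 1) * (s + m + 2)) ∧
      (m + 1) / 2 ≤ (s + 2) / 2 * (1 - s * (s + 1) / ((s + m + 1) * (s + m + 2))) ∧
      s * (s + 1) * (s + 2) / ((s + m) * (s + m + 1) * (s + m + 2)) * (m + 1) ≤
        (s + 2) / 2 * (1 - s * (s + 1) / ((s + m + 1) * (s + m + 2))) := by
  have hsp : 0 < s := by linarith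
  have hS : (s + 2) / 2 * (1 - s * (s + 1) / ((s + m + 1) * (s + m + 2))) =
      (s + 2) * (m + 1) * (2 * s + m + 2) / (2 * ((s + m + 1) * (s + m + 2))) := by
    field_simp; ring
  refine ⟨by positivity, ?_, ?_⟩
  · rw [hS, div_le_div_iff₀ (by positivity) (by positivity)]
    have h1 : (s + m + 1) * (s + m + 2) ≤ (s + 2) * (2 * s + m + 2) := by nlinarith
    have h2 := mul_le_mul_of_nonneg_left h1 (show 0 ≤ 2 * (m + 1) by positivity)
    linarith
  -- The velocity decays, so the last one times the number of steps is at most the total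
  -- displacement.
  · have h1 : 2 * (s * (s + 1)) ≤ (2 * s + m + 2) * (s + m) := by nlinarith
    rw [hS, show s * (s + 1) * (s + 2) / ((s + m) * (s + m + 1) * (s + m + 2)) * (m + 1) =
        (s + 2) * (m + 1) * (2 * (s * (s + 1)) / (s + m)) / (2 * ((s + m + 1) * (s + m + 2))) by
      field_simp]
    gcongr
    rwa [div_le_iff₀ (by positivity)]

/-- One period: if curvature is met at time `s` only, then the difference at time `s + T` is
at least three times as large. -/
theorem linNag_period {h : ℝ} {s T : ℕ} (h0 : 0 < h) (hT : 10 ≤ h * T)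
    (hs : 2 * T ≤ s) (hκ : κ s = h) (hκ0 : ∀ i, s < i → i < s + T → κ i = 0)
    (hρ : ∃ ρ, 0 ≤ ρ ∧ ρ ≤ 3 / 20 * h ∧ (linNag κ ε s).2 = (1 + ρ) * (linNag κ ε s).1) :
    3 * |(linNag κ ε s).1| ≤ |(linNag κ ε (s + T)).1| ∧
      ∃ ρ, 0 ≤ ρ ∧ ρ ≤ 3 / 20 * h ∧
        (linNag κ ε (s + T)).2 = (1 + ρ) * (linNag κ ε (s + T)).1 := by
  have hT0 : 0 < T := by
    rcases Nat.eq_zero_or_pos T with rfl | h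
    · norm_num at hT
    · exact h
  obtain ⟨m, rfl⟩ : ∃ m, T = m + 1 := ⟨T - 1, by omega⟩
  obtain ⟨ρ, hρ0, hρ1, he⟩ := hρ
  obtain ⟨hu, hd⟩ := linNag_coast (κ := κ) (ε := ε) (s := s) (by omega) m
    fun i hi hi' => hκ0 i hi (by omega)
  obtain ⟨hP0, hS1, hPS⟩ := linNag_coast_coeff_bounds (s := s) (m := m) (by positivity)
    (by exact_mod_cast hs)
  have hU : (linNag κ ε (s + 1)).1 - (linNag κ ε s).1 =
      -(h * (1 + ρ) - ρ) * (linNag κ ε s).1 := by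
    rw [linNag_succ_fst, hκ, he]; ring
  -- Residual momentum `ρ` opposes the kick; the bound `3 / 20 * h` leaves 17/20 of it.
  have hμ0 : 17 / 20 * h ≤ h * (1 + ρ) - ρ := by nlinarith [mul_nonneg h0.le hρ0]
  rw [hU] at hu hd
  generalize h * (1 + ρ) - ρ = μ at *
  generalize (s : ℝ) * (s + 1) * (s + 2) / ((s + m) * (s + m + 1) * (s + m + 2)) = P at *
  generalize ((s : ℝ) + 2) / 2 * (1 - s * (s + 1) / ((s + m + 1) * (s + m + 2))) = S at *
  push_cast at hT
  have hm : (0 : ℝ) ≤ m := by positivity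
  have hμ : 0 ≤ μ := by linarith
  have hμS : 17 / 4 ≤ μ * S := by
    calc (17 / 4 : ℝ) ≤ (17 / 20 * h) * ((m + 1) / 2) := by linarith
      _ ≤ μ * S := by gcongr
  have hd' : (linNag κ ε (s + (m + 1))).1 = -(μ * S - 1) * (linNag κ ε s).1 := by
    rw [← add_assoc, hd]; ring
  have hμP : 0 ≤ μ * P := mul_nonneg hμ hP0
  refine ⟨?_, nagGamma (s + m + 1) * (μ * P) / (μ * S - 1), ?_, ?_, ?_⟩
  · rw [hd', abs_mul, abs_neg, abs_of_nonneg (by linarith : 0 ≤ μ * S - 1)]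
    gcongr
    linarith
  · exact div_nonneg (mul_nonneg (nagGamma_succ_nonneg _) hμP) (by linarith)
  · rw [div_le_iff₀ (by linarith)]
    refine (mul_le_of_le_one_left hμP (nagGamma_succ_le_one _)).trans ?_
    -- Together with `10 ≤ h * T` this gives `μ * P ≤ h / 10 * (μ * S)`. Since `μ * S ≥ 17 / 4`, the
    -- new ratio is at most `17 / 130 * h`, so the invariant `3 / 20 * h` is restored.
    have h4 : μ * P * (m + 1) ≤ μ * S := by
      rw [mul_assoc]; exact mul_le_mul_of_nonneg_left hPS hμ
    have h5 : μ * P * 10 ≤ μ * P * (h * (m + 1)) := by gcongr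
    have h6 := mul_le_mul_of_nonneg_left h4 h0.le
    have h7 := mul_le_mul_of_nonneg_left hμS h0.le
    linarith
  · have h6 : μ * S - 1 ≠ 0 := by linarith
    rw [hd', ← add_assoc, linNag_succ_snd, hu, add_assoc s m 1, hd']
    field_simp
    ring

/-- If no curvature is met from time `n` on, the difference does not shrink. -/
theorem linNag_abs_le_of_forall_eq_zero {n : ℕ} (h : ∀ t, n ≤ t → κ t = 0)
    (hρ : 0 ≤ ((linNag κ ε n).2 - (linNag κ ε n).1) * (linNag κ ε n).1) (t : ℕ) (ht : n ≤ t) :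
    |(linNag κ ε n).1| ≤ |(linNag κ ε t).1| := by
  -- The invariant to carry along: the momentum never points towards zero.
  suffices 0 ≤ ((linNag κ ε t).2 - (linNag κ ε t).1) * (linNag κ ε t).1 ∧
      |(linNag κ ε n).1| ≤ |(linNag κ ε t).1| from this.2
  induction t, ht using Nat.le_induction with
  | base => exact ⟨hρ, le_rfl⟩
  | succ t ht ih =>
    obtain ⟨ih1, ih2⟩ := ih
    rw [linNag_succ_snd, linNag_succ_fst, h t ht]
    set d := (linNag κ ε t).1
    set e := (linNag κ ε t).2
    refine ⟨?_, ih2.trans ?_⟩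
    · have := mul_nonneg (nagGamma_succ_nonneg t)
        (show 0 ≤ (e - d) * e by nlinarith [sq_nonneg (e - d)])
      nlinarith
    · rw [sub_zero, one_mul]
      exact sq_le_sq.mp (by nlinarith [sq_nonneg (e - d)])

end linNag

/-! ### Convex functions whose gradient is a sum of ramps -/

/-- The ramp that rises with slope one from `0` to `D` starting at `a`. -/
noncomputable def ramp (a D y : ℝ) : ℝ := max 0 (min (y - a) D)

section ramp

variable {a D : ℝ}

theorem ramp_nonneg (y : ℝ) : 0 ≤ ramp a D y := le_max_left _ _

theorem ramp_le (hD : 0 ≤ D) (y : ℝ) : ramp a D y ≤ D := max_le hD (min_le_right _ _)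

theorem ramp_mono : Monotone (ramp a D) := fun u v h => by unfold ramp; gcongr

theorem continuous_ramp : Continuous (ramp a D) := by unfold ramp; fun_prop

theorem ramp_of_le {y : ℝ} (h : y ≤ a) : ramp a D y = 0 :=
  max_eq_left ((min_le_left _ _).trans (by linarith))

theorem ramp_of_ge (hD : 0 ≤ D) {y : ℝ} (h : a + D ≤ y) : ramp a D y = D := by
  rw [ramp, min_eq_right (by linarith), max_eq_right hD]

theorem ramp_of_mem {y : ℝ} (h : a ≤ y) (h' : y ≤ a + D) : ramp a D y = y - a := by
  rw [ramp, min_eq_left (by linarith), max_eq_right (by linarith)]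

theorem ramp_sub_ramp_le {u v : ℝ} (h : u ≤ v) : ramp a D v - ramp a D u ≤ v - u := by
  unfold ramp
  rcases max_cases 0 (min (v - a) D) with h1 | h1 <;> rcases max_cases 0 (min (u - a) D) with h2 | h2 <;>
  rcases min_cases (v - a) D with h3 | h3 <;> rcases min_cases (u - a) D with h4 | h4 <;> linarith

/-- A sum of ramps that rise over non-overlapping intervals is `1`-Lipschitz. -/
theorem sum_ramp_sub_sum_ramp_le (K : Finset ℕ) {a D : ℕ → ℝ} (hD : ∀ s ∈ K, 0 ≤ D s)
    (hsep : ∀ s ∈ K, ∀ r ∈ K, s < r → a s + D s ≤ a r) :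
    ∀ u v : ℝ, u ≤ v →
      ∑ s ∈ K, ramp (a s) (D s) v - ∑ s ∈ K, ramp (a s) (D s) u ≤ v - u := by
  induction K using Finset.induction_on_max with
  | empty => intro u v h; simpa using h
  | insert m K hm ih =>
    have hmK : m ∉ K := fun h => lt_irrefl _ (hm m h)
    have ih := ih (fun s hs => hD s (Finset.mem_insert_of_mem hs)) fun s hs r hr =>
      hsep s (Finset.mem_insert_of_mem hs) r (Finset.mem_insert_of_mem hr)
    have hconst : ∀ y, a m ≤ y → ∑ s ∈ K, ramp (a s) (D s) y = ∑ s ∈ K, D s := fun y hy =>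
      Finset.sum_congr rfl fun s hs => ramp_of_ge (hD s (Finset.mem_insert_of_mem hs))
        ((hsep s (Finset.mem_insert_of_mem hs) m (Finset.mem_insert_self _ _) (hm s hs)).trans hy)
    intro u v huv
    rw [Finset.sum_insert hmK, Finset.sum_insert hmK]
    -- Left of `a m` the last ramp vanishes; right of it all the others are saturated. An interval
    -- containing `a m` is split there.
    rcases le_total v (a m) with hv | hv
    · rw [ramp_of_le hv, ramp_of_le (huv.trans hv)]
      linarith [ih u v huv]
    rcases le_total (a m) u with hu | hu
    · rw [hconst u hu, hconst v hv]
      linarith [ramp_sub_ramp_le (a := a m) (D := D m) huv]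
    · have h1 := ih u (a m) hu
      have h2 := ramp_sub_ramp_le (a := a m) (D := D m) hv
      rw [ramp_of_le le_rfl, sub_zero] at h2
      rw [hconst _ le_rfl] at h1
      rw [hconst v hv, ramp_of_le hu]
      linarith

/-- A convex function whose gradient rises from `-β ∑ D s` to `0` along disjoint ramps. -/
theorem exists_convex_smooth_of_ramps {β G : ℝ} (hβ : 0 ≤ β) (K : Finset ℕ) {a D : ℕ → ℝ}
    (hD : ∀ s ∈ K, 0 ≤ D s) (hsep : ∀ s ∈ K, ∀ r ∈ K, s < r → a s + D s ≤ a r)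
    (hG : β * ∑ s ∈ K, D s ≤ G) :
    ∃ f : ℝ → ℝ, ConvexOn ℝ Set.univ f ∧ IsSmooth β f ∧
      (∀ u v : ℝ, |f u - f v| ≤ G * |u - v|) ∧ (∃ z : ℝ, ∀ u : ℝ, f z ≤ f u) ∧
      ∀ y, gradient f y = -(β * ∑ s ∈ K, (D s - ramp (a s) (D s) y)) := by
  set F : ℝ → ℝ := fun y => -(β * ∑ s ∈ K, (D s - ramp (a s) (D s) y)) with hF
  have hcont : Continuous F := by
    refine (continuous_const.mul (continuous_finsetSum _ fun s _ => ?_)).neg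
    exact continuous_const.sub continuous_ramp
  have hmono : Monotone F := fun u v h => by
    simp only [hF]
    gcongr with s hs
    exact ramp_mono h
  have hnonpos : ∀ y, F y ≤ 0 := fun y => by
    simp only [hF, Left.neg_nonpos_iff]
    exact mul_nonneg hβ (Finset.sum_nonneg fun s hs => sub_nonneg.2 (ramp_le (hD s hs) y))
  have hbound : ∀ y, ‖F y‖ ≤ G := fun y => by
    rw [Real.norm_of_nonpos (hnonpos y)]
    simp only [hF, neg_neg]
    refine le_trans ?_ hG
    gcongr with s hs
    linarith [ramp_nonneg (a := a s) (D := D s) y]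
  have hderiv : ∀ y, HasDerivAt (fun y => ∫ x in (0 : ℝ)..y, F x) (F y) y := fun y =>
    (hcont.integral_hasStrictDerivAt 0 y).hasDerivAt
  have hdiff : Differentiable ℝ (fun y => ∫ x in (0 : ℝ)..y, F x) := fun y =>
    (hderiv y).differentiableAt
  have hderiv' : deriv (fun y => ∫ x in (0 : ℝ)..y, F x) = F := funext fun y => (hderiv y).deriv
  have hgrad : ∀ y, gradient (fun y => ∫ x in (0 : ℝ)..y, F x) y = F y := fun y => by
    rw [gradient_eq_deriv', hderiv']
  have hlip : ∀ u v, u ≤ v → F v - F u ≤ β * (v - u) := fun u v h => by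
    have := mul_le_mul_of_nonneg_left (sum_ramp_sub_sum_ramp_le K hD hsep u v h) hβ
    simp only [hF, Finset.sum_sub_distrib]
    linarith
  refine ⟨fun y => ∫ x in (0 : ℝ)..y, F x, ?_, ⟨hdiff, ?_⟩, ?_, ?_, hgrad⟩
  · exact Monotone.convexOn_univ_of_deriv hdiff (by rwa [hderiv'])
  · intro u v
    rw [hgrad, hgrad, Real.norm_eq_abs, Real.norm_eq_abs]
    rcases le_total u v with h | h
    · rw [abs_of_nonpos (by linarith [hmono h]), abs_of_nonpos (by linarith)]
      linarith [hlip u v h]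
    · rw [abs_of_nonneg (by linarith [hmono h]), abs_of_nonneg (by linarith)]
      linarith [hlip v u h]
  · intro u v
    exact convex_univ.norm_image_sub_le_of_norm_deriv_le (fun x _ => hdiff x)
      (fun x _ => by rw [hderiv']; exact hbound x) (Set.mem_univ v) (Set.mem_univ u)
  -- Past the last ramp the gradient is zero, and it is nonpositive everywhere, so any such `z` is a
  -- minimiser.
  · obtain ⟨z, hz⟩ : ∃ z, ∀ s ∈ K, a s + D s ≤ z := by
      obtain ⟨z, hz⟩ := (K.image fun s => a s + D s).bddAbove
      exact ⟨z, fun s hs => hz (Finset.mem_coe.2 (Finset.mem_image_of_mem _ hs))⟩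
    have hzero : ∀ y, z ≤ y → F y = 0 := fun y hy => by
      simp only [hF]
      rw [Finset.sum_eq_zero fun s hs => by rw [ramp_of_ge (hD s hs) ((hz s hs).trans hy), sub_self]]
      simp
    refine ⟨z, fun u => ?_⟩
    exact isMinOn_univ_of_deriv hdiff.continuous.continuousAt (fun x _ => (hdiff x).differentiableWithinAt)
      (fun x _ => (hdiff x).differentiableWithinAt) (fun x _ => by rw [hderiv']; exact hnonpos x)
      (fun x hx => by rw [hderiv', hzero x (le_of_lt hx)]) (Set.mem_univ u)

end ramp

/-! ### NAG with prescribed gradients -/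

section drivenNag

variable {g : ℕ → ℝ} {x₀ η : ℝ}

theorem drivenNag_succ_fst (t : ℕ) :
    (drivenNag g x₀ η (t + 1)).1 = (drivenNag g x₀ η t).2 + η * g t := rfl

theorem drivenNag_succ_snd (t : ℕ) :
    (drivenNag g x₀ η (t + 1)).2 = (drivenNag g x₀ η (t + 1)).1 +
      nagGamma (t + 1) * ((drivenNag g x₀ η (t + 1)).1 - (drivenNag g x₀ η t).1) := rfl

/-- The gradient is tested only along the driven trajectory, which is known before `f` is; this lets
`f` be constructed afterwards. -/
theorem nag_eq_drivenNag {f : ℝ → ℝ} (h : ∀ t, gradient f (drivenNag g x₀ η t).2 = -g t) (t : ℕ) :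
    nag f x₀ η t = drivenNag g x₀ η t := by
  induction t with
  | zero => rfl
  | succ t ih =>
    simp only [nag, drivenNag, ih, h t, smul_eq_mul, mul_neg, sub_neg_eq_add]

theorem drivenNag_sub_drivenNag {g' κ : ℕ → ℝ} {ε : ℝ}
    (h : ∀ t, η * (g' t - g t) = -κ t * (linNag κ ε t).2) (t : ℕ) :
    (drivenNag g' (x₀ + ε) η t).1 - (drivenNag g x₀ η t).1 = (linNag κ ε t).1 ∧
      (drivenNag g' (x₀ + ε) η t).2 - (drivenNag g x₀ η t).2 = (linNag κ ε t).2 := by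
  induction t with
  | zero => simp [drivenNag, linNag]
  | succ t ih =>
    obtain ⟨ih1, ih2⟩ := ih
    have h1 : (drivenNag g' (x₀ + ε) η (t + 1)).1 - (drivenNag g x₀ η (t + 1)).1 =
        (linNag κ ε (t + 1)).1 := by
      rw [drivenNag_succ_fst, drivenNag_succ_fst, linNag_succ_fst]
      linarith [h t]
    refine ⟨h1, ?_⟩
    rw [drivenNag_succ_snd, drivenNag_succ_snd, linNag_succ_snd, ← h1, ← ih1]
    ring

/-- The momentum at time `n` when the negated gradients were at least `c` before. -/
theorem le_drivenNag_snd_sub_fst {c : ℝ} (hη : 0 ≤ η) (n : ℕ) (h : ∀ t < n, c ≤ g t) :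
    η * c * (n - 1) / 4 ≤ (drivenNag g x₀ η n).2 - (drivenNag g x₀ η n).1 ∨ n = 0 := by
  induction n with
  | zero => exact .inr rfl
  | succ n ih =>
    left
    have h1 : η * c ≤ η * g n := mul_le_mul_of_nonneg_left (h n n.lt_succ_self) hη
    rw [drivenNag_succ_snd, drivenNag_succ_fst, nagGamma_succ]
    rcases ih fun t ht => h t (by omega) with ih | rfl
    · have h2 : η * c * (n + 3) / 4 ≤
          (drivenNag g x₀ η n).2 + η * g n - (drivenNag g x₀ η n).1 := by linarith
      have h3 := mul_le_mul_of_nonneg_left h2 (show (0 : ℝ) ≤ n / (n + 3) by positivity)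
      rw [show (n : ℝ) / (n + 3) * (η * c * (n + 3) / 4) = η * c * n / 4 by field_simp] at h3
      push_cast
      linarith
    · simp

theorem drivenNag_fst_le_snd (hη : 0 ≤ η) (hg : ∀ t, 0 ≤ g t) (n : ℕ) :
    (drivenNag g x₀ η n).1 ≤ (drivenNag g x₀ η n).2 := by
  rcases le_drivenNag_snd_sub_fst (x₀ := x₀) hη n (fun t _ => hg t) with h | rfl
  · linarith
  · rfl

theorem drivenNag_snd_succ_sub_snd (t : ℕ) :
    (drivenNag g x₀ η (t + 1)).2 - (drivenNag g x₀ η t).2 =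
      η * g t + ((drivenNag g x₀ η (t + 1)).2 - (drivenNag g x₀ η (t + 1)).1) := by
  rw [drivenNag_succ_fst]; ring

theorem drivenNag_snd_mono (hη : 0 ≤ η) (hg : ∀ t, 0 ≤ g t) :
    Monotone fun t => (drivenNag g x₀ η t).2 :=
  monotone_nat_of_le_succ fun t => by
    linarith [drivenNag_snd_succ_sub_snd (g := g) (x₀ := x₀) (η := η) t, mul_nonneg hη (hg t),
      drivenNag_fst_le_snd (x₀ := x₀) hη hg (t + 1)]

/-- After enough steps with negated gradients at least `c`, the next two steps are long. -/
theorem drivenNag_snd_long_steps {c D : ℝ} (hη : 0 ≤ η) (hg : ∀ t, 0 ≤ g t) {s : ℕ} (hs : 2 ≤ s)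
    (h : ∀ t < s, c ≤ g t) (hD : 0 ≤ D) (hDc : 4 * D ≤ η * c * (s - 1)) :
    (∀ t < s, (drivenNag g x₀ η t).2 ≤ (drivenNag g x₀ η s).2 - D) ∧
      ∀ t, s < t → (drivenNag g x₀ η s).2 + D / 3 ≤ (drivenNag g x₀ η t).2 := by
  have hmono := drivenNag_snd_mono (x₀ := x₀) hη hg
  have hq := (le_drivenNag_snd_sub_fst (x₀ := x₀) hη s h).resolve_right (by omega)
  constructor
  · intro t ht
    obtain ⟨r, rfl⟩ : ∃ r, s = r + 1 := ⟨s - 1, by omega⟩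
    have h1 := hmono (show t ≤ r by omega)
    have h2 := drivenNag_snd_succ_sub_snd (g := g) (x₀ := x₀) (η := η) r
    have h3 := mul_nonneg hη (hg r)
    dsimp only at h1
    linarith
  · intro t ht
    have h1 := hmono (show s + 1 ≤ t by omega)
    have h2 := drivenNag_snd_succ_sub_snd (g := g) (x₀ := x₀) (η := η) s
    have h3 := mul_nonneg hη (hg s)
    have h4 := drivenNag_succ_snd (g := g) (x₀ := x₀) (η := η) s
    -- The gradient at time `s` may vanish, so the next step relies on momentum alone; its
    -- coefficient `s / (s + 3)` is at least `2 / 5`.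
    have h5 : (1 / 3 : ℝ) ≤ nagGamma (s + 1) := by
      have : (2 : ℝ) ≤ s := by exact_mod_cast hs
      rw [nagGamma_succ, div_le_div_iff₀ (by positivity) (by positivity)]
      linarith
    have h6 : D ≤ (drivenNag g x₀ η (s + 1)).1 - (drivenNag g x₀ η s).1 := by
      rw [drivenNag_succ_fst]; linarith
    have h7 := mul_le_mul h5 h6 hD (nagGamma_succ_nonneg s)
    dsimp only at h1
    linarith

end drivenNag

/-! ### Realising a difference sequence by an actual function -/

/-- For a finite set `K` of times and a difference sequence that meets curvature `β` exactly at the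
times in `K`, some function drives two runs of NAG so that they differ by that sequence. -/
theorem exists_nag_sub_nag_eq_linNag {ε G β η : ℝ} (hβ : 0 < β) (hη : 0 < η) (K : Finset ℕ)
    (hK : ∀ s ∈ K, 2 ≤ s ∧ 12 ≤ η * β * (s - 1)) {κ : ℕ → ℝ}
    (hκ : ∀ t, κ t = if t ∈ K then η * β else 0)
    (hG : β * ∑ s ∈ K, |(linNag κ ε s).2| ≤ G) :
    ∃ f : ℝ → ℝ, ConvexOn ℝ Set.univ f ∧ IsSmooth β f ∧
      (∀ u v : ℝ, |f u - f v| ≤ G * |u - v|) ∧ (∃ z : ℝ, ∀ u : ℝ, f z ≤ f u) ∧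
      ∀ t, nagX f η t ε - nagX f η t 0 = (linNag κ ε t).1 := by
  set e : ℕ → ℝ := fun t => (linNag κ ε t).2 with he
  -- the share of the ramp at time `s` that the run still sees at time `t`, for both runs
  set w : (ℝ → ℝ) → ℕ → ℕ → ℝ := fun σ s t =>
    if t < s then |e s| else if t = s then max 0 (σ (e s)) else 0 with hw
  -- `σ = id` belongs to the run from `0`, `σ = Neg.neg` to the run from `ε`: at time `s` the run
  -- that is behind sees the whole ramp and the one ahead sees none of it.
  set g : (ℝ → ℝ) → ℕ → ℝ := fun σ t => β * ∑ s ∈ K, w σ s t with hg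
  have hw0 : ∀ σ s t, 0 ≤ w σ s t := fun σ s t => by
    simp only [hw]; split_ifs <;> positivity
  have hg0 : ∀ σ t, 0 ≤ g σ t := fun σ t =>
    mul_nonneg hβ.le (Finset.sum_nonneg fun s _ => hw0 σ s t)
  have hgK : ∀ σ, ∀ s ∈ K, ∀ t < s, β * |e s| ≤ g σ t := fun σ s hs t ht => by
    refine mul_le_mul_of_nonneg_left ?_ hβ.le
    refine le_trans ?_ (Finset.single_le_sum (fun s _ => hw0 σ s t) hs)
    simp only [hw, if_pos ht, le_refl]
  set Y : ℕ → ℝ := fun t => (drivenNag (g id) 0 η t).2 with hY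
  set Y' : ℕ → ℝ := fun t => (drivenNag (g Neg.neg) (0 + ε) η t).2 with hY'
  have hdiff := drivenNag_sub_drivenNag (g := g id) (x₀ := 0) (η := η) (g' := g Neg.neg)
    (κ := κ) (ε := ε) fun t => by
      have h1 : ∀ s, w Neg.neg s t - w id s t = if s = t then -e t else 0 := fun s => by
        simp only [hw]
        rcases lt_trichotomy t s with h | rfl | h
        · simp [h, h.ne']
        · simp only [lt_irrefl, if_false, if_true, id]
          rcases le_total 0 (e t) with h | h
          · rw [max_eq_left (by linarith), max_eq_right h]; ring
          · rw [max_eq_right (by linarith), max_eq_left h]; ring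
        · simp [h.not_gt, h.ne, h.ne']
      simp only [hg]
      rw [← mul_sub, ← Finset.sum_sub_distrib, Finset.sum_congr rfl fun s _ => h1 s,
        Finset.sum_ite_eq', hκ]
      split_ifs
      · simp only [he]; ring
      · ring
  have hYe : ∀ t, Y' t - Y t = e t := fun t => (hdiff t).2
  have hlong : ∀ σ x₀, ∀ s ∈ K,
      (∀ t < s, (drivenNag (g σ) x₀ η t).2 ≤ (drivenNag (g σ) x₀ η s).2 - |e s|) ∧
        ∀ t, s < t → (drivenNag (g σ) x₀ η s).2 + |e s| ≤ (drivenNag (g σ) x₀ η t).2 :=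
    fun σ x₀ s hs => by
      -- The width is tripled because the step after `s` is only guaranteed a third of `D`. The 12
      -- in `hK` is `4 * 3`.
      obtain ⟨h1, h2⟩ := drivenNag_snd_long_steps (x₀ := x₀) (D := 3 * |e s|) hη.le (hg0 σ)
        (hK s hs).1 (hgK σ s hs) (by positivity) (by
          have := mul_le_mul_of_nonneg_right (hK s hs).2 (abs_nonneg (e s))
          linarith)
      refine ⟨fun t ht => ?_, fun t ht => ?_⟩
      · linarith [h1 t ht, abs_nonneg (e s)]
      · linarith [h2 t ht]
  -- The ramp for `s` starts at the run that is behind and ends at the one ahead.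
  set a : ℕ → ℝ := fun s => min (Y s) (Y' s) with ha
  have hYa : ∀ s, a s ≤ Y s ∧ a s ≤ Y' s ∧ Y s ≤ a s + |e s| ∧ Y' s ≤ a s + |e s| ∧
      Y s = a s + max 0 (-e s) ∧ Y' s = a s + max 0 (e s) := fun s => by
    have h := hYe s
    simp only [ha]
    rcases le_total 0 (e s) with h0 | h0
    · rw [min_eq_left (by linarith), abs_of_nonneg h0, max_eq_left (by linarith), max_eq_right h0]
      refine ⟨?_, ?_, ?_, ?_, ?_, ?_⟩ <;> linarith
    · rw [min_eq_right (by linarith), abs_of_nonpos h0, max_eq_right (by linarith), max_eq_left h0]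
      refine ⟨?_, ?_, ?_, ?_, ?_, ?_⟩ <;> linarith
  have hbefore : ∀ s ∈ K, ∀ t < s, Y t ≤ a s ∧ Y' t ≤ a s := fun s hs t ht => by
    obtain ⟨-, -, h1, h2, -⟩ := hYa s
    have h3 := (hlong id 0 s hs).1 t ht
    have h4 := (hlong Neg.neg (0 + ε) s hs).1 t ht
    simp only [hY, hY'] at *
    constructor <;> linarith
  have hafter : ∀ s ∈ K, ∀ t, s < t → a s + |e s| ≤ Y t ∧ a s + |e s| ≤ Y' t :=
    fun s hs t ht => by
      obtain ⟨h1, h2, -⟩ := hYa s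
      have h3 := (hlong id 0 s hs).2 t ht
      have h4 := (hlong Neg.neg (0 + ε) s hs).2 t ht
      simp only [hY, hY'] at *
      constructor <;> linarith
  obtain ⟨f, hconv, hsmooth, hlip, hmin, hgrad⟩ :=
    exists_convex_smooth_of_ramps (a := a) (D := fun s => |e s|) hβ.le K
      (fun s _ => abs_nonneg _)
      (fun s hs r _ hsr => le_min (hafter s hs r hsr).1 (hafter s hs r hsr).2) hG
  have habs : ∀ x : ℝ, |x| - max 0 (-x) = max 0 x ∧ |x| - max 0 x = max 0 (-x) := fun x => by
    rcases le_total 0 x with h | h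
    · rw [abs_of_nonneg h, max_eq_left (by linarith : -x ≤ 0), max_eq_right h]; simp
    · rw [abs_of_nonpos h, max_eq_right (by linarith : 0 ≤ -x), max_eq_left h]; simp
  have hramp : ∀ s ∈ K, ∀ t, |e s| - ramp (a s) |e s| (Y t) = w id s t ∧
      |e s| - ramp (a s) |e s| (Y' t) = w Neg.neg s t := fun s hs t => by
    simp only [hw]
    rcases lt_trichotomy t s with h | rfl | h
    · rw [ramp_of_le (hbefore s hs t h).1, ramp_of_le (hbefore s hs t h).2]
      simp [h]
    · obtain ⟨h1, h2, h3, h4, h5, h6⟩ := hYa t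
      rw [ramp_of_mem h1 h3, ramp_of_mem h2 h4, h5, h6]
      simp only [lt_irrefl, if_false, if_true, id, add_sub_cancel_left]
      exact habs (e t)
    · rw [ramp_of_ge (abs_nonneg _) (hafter s hs t h).1, ramp_of_ge (abs_nonneg _) (hafter s hs t h).2]
      simp [h.not_gt, h.ne']
  refine ⟨f, hconv, hsmooth, hlip, hmin, fun t => ?_⟩
  have h1 : nag f 0 η t = drivenNag (g id) 0 η t := nag_eq_drivenNag (fun t => by
    rw [hgrad]
    exact congrArg (fun x => -(β * x)) (Finset.sum_congr rfl fun s hs => (hramp s hs t).1)) t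
  have h2 : nag f (0 + ε) η t = drivenNag (g Neg.neg) (0 + ε) η t := nag_eq_drivenNag (fun t => by
    rw [hgrad]
    exact congrArg (fun x => -(β * x)) (Finset.sum_congr rfl fun s hs => (hramp s hs t).2)) t
  have h3 := (hdiff t).1
  rw [← h1, ← h2, zero_add] at h3
  exact h3

/-! ### Periodic kicks and when to stop them -/

/-- When curvature `h` is met at the times `T (j + 2)`, the difference triples from each of these
times to the next. -/
theorem linNag_periodic {κ : ℕ → ℝ} {ε h : ℝ} {T : ℕ} (h0 : 0 < h) (hT : 10 ≤ h * T)
    (hκ : ∀ t, κ t = if T ∣ t ∧ 2 * T ≤ t then h else 0) :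
    (∀ t ≤ 2 * T, linNag κ ε t = (ε, ε)) ∧ ∀ j : ℕ,
      3 * |(linNag κ ε (T * (j + 2))).1| ≤ |(linNag κ ε (T * (j + 1 + 2))).1| ∧
      ∃ ρ, 0 ≤ ρ ∧ ρ ≤ 3 / 20 * h ∧
        (linNag κ ε (T * (j + 2))).2 = (1 + ρ) * (linNag κ ε (T * (j + 2))).1 := by
  have hstart := linNag_eq_of_forall_eq_zero (κ := κ) (ε := ε) (n := 2 * T) fun t ht => by
    rw [hκ, if_neg (by omega)]
  refine ⟨hstart, fun j => ?_⟩
  have step : ∀ j : ℕ, (∃ ρ, 0 ≤ ρ ∧ ρ ≤ 3 / 20 * h ∧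
      (linNag κ ε (T * (j + 2))).2 = (1 + ρ) * (linNag κ ε (T * (j + 2))).1) →
      3 * |(linNag κ ε (T * (j + 2))).1| ≤ |(linNag κ ε (T * (j + 1 + 2))).1| ∧
      ∃ ρ, 0 ≤ ρ ∧ ρ ≤ 3 / 20 * h ∧
        (linNag κ ε (T * (j + 1 + 2))).2 = (1 + ρ) * (linNag κ ε (T * (j + 1 + 2))).1 :=
    fun j hj => by
      rw [show T * (j + 1 + 2) = T * (j + 2) + T by ring]
      have hle : 2 * T ≤ T * (j + 2) := by nlinarith
      refine linNag_period h0 hT hle ?_ (fun i hi hi' => ?_) hj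
      · rw [hκ, if_pos ⟨dvd_mul_right _ _, hle⟩]
      · rw [hκ, if_neg]
        rintro ⟨⟨q, rfl⟩, -⟩
        have h1 := lt_of_mul_lt_mul_left hi (Nat.zero_le T)
        have h2 : q < j + 3 := lt_of_mul_lt_mul_left (a := T) (by linarith) (Nat.zero_le T)
        omega
  have hex : ∃ ρ, 0 ≤ ρ ∧ ρ ≤ 3 / 20 * h ∧
      (linNag κ ε (T * (j + 2))).2 = (1 + ρ) * (linNag κ ε (T * (j + 2))).1 := by
    induction j with
    | zero =>
      -- Before the first kick the difference is constant and carries no momentum.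
      refine ⟨0, le_rfl, by positivity, ?_⟩
      rw [hstart _ (by linarith)]; simp
    | succ j ih => exact (step j ih).2
  exact ⟨(step j hex).1, hex⟩

theorem pow_mul_le_of_forall_mul_le {A : ℕ → ℝ} {r : ℝ} (hr : 0 ≤ r)
    (h : ∀ j, r * A j ≤ A (j + 1)) (n : ℕ) : r ^ n * A 0 ≤ A n := by
  induction n with
  | zero => simp
  | succ n ih =>
    calc r ^ (n + 1) * A 0 = r * (r ^ n * A 0) := by ring
      _ ≤ r * A n := by gcongr
      _ ≤ A (n + 1) := h n

/-- Read backwards the terms are dominated by a geometric series of ratio 1/3, whose sum is 3/2. -/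
theorem sum_range_succ_le_of_forall_three_mul_le {A : ℕ → ℝ} (h0 : 0 ≤ A 0)
    (h : ∀ j, 3 * A j ≤ A (j + 1)) (n : ℕ) : ∑ j ∈ Finset.range (n + 1), A j ≤ 3 / 2 * A n := by
  induction n with
  | zero => simp; linarith
  | succ n ih => rw [Finset.sum_range_succ]; linarith [h n]

/-- The difference sequence that is stopped from meeting curvature once it exceeds `θ`. -/
theorem exists_linNag_growth {ε h θ : ℝ} {T : ℕ} (hε : 0 < ε) (h0 : 0 < h) (h1 : h ≤ 1)
    (hT : 10 ≤ h * T) (hθ : 0 < θ) :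
    ∃ (k : ℕ) (K : Finset ℕ) (κ : ℕ → ℝ), (∀ t, κ t = if t ∈ K then h else 0) ∧
      (∀ s ∈ K, 2 * T ≤ s) ∧
      ∑ s ∈ K, |(linNag κ ε s).2| ≤ 2 * θ ∧
      (∀ j ≤ k, 3 ^ j * ε ≤ |(linNag κ ε (T * (j + 2))).1|) ∧
      (∀ t, T * (k + 2) ≤ t ∨ k = 0 → θ ≤ |(linNag κ ε t).1|) ∧
      (0 < k → 3 ^ (k - 1) * ε < θ) := by
  have hT0 : 0 < T := by
    rcases Nat.eq_zero_or_pos T with rfl | h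
    · norm_num at hT
    · exact h
  set κ' : ℕ → ℝ := fun t => if T ∣ t ∧ 2 * T ≤ t then h else 0 with hκ'
  obtain ⟨hstart, hper⟩ := linNag_periodic (κ := κ') (ε := ε) h0 hT fun t => rfl
  set A : ℕ → ℝ := fun j => |(linNag κ' ε (T * (j + 2))).1| with hA
  have hA0 : A 0 = ε := by
    simp only [hA]; rw [hstart _ (by linarith)]; exact abs_of_pos hε
  have hA3 : ∀ j, 3 * A j ≤ A (j + 1) := fun j => (hper j).1
  have hpow : ∀ j, 3 ^ j * ε ≤ A j := fun j => hA0 ▸ pow_mul_le_of_forall_mul_le (by norm_num) hA3 j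
  have hex : ∃ k, θ ≤ A k := by
    obtain ⟨k, hk⟩ := pow_unbounded_of_one_lt (θ / ε) (by norm_num : (1 : ℝ) < 3)
    exact ⟨k, ((div_lt_iff₀ hε).1 hk).le.trans (hpow k)⟩
  classical
  -- The kicks with index `j < k` are kept, where `k` is the first index at which the difference has
  -- reached `θ`.
  obtain ⟨k, hk, hmin⟩ : ∃ k, θ ≤ A k ∧ ∀ j < k, A j < θ :=
    ⟨Nat.find hex, Nat.find_spec hex, fun j hj => not_le.1 (Nat.find_min hex hj)⟩
  have hinj : Function.Injective fun j => T * (j + 2) := fun i j hij => by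
    have := Nat.eq_of_mul_eq_mul_left hT0 hij
    omega
  set K : Finset ℕ := (Finset.range k).image fun j => T * (j + 2) with hK
  set κ : ℕ → ℝ := fun t => if t ∈ K then h else 0 with hκ
  have hmem : ∀ t, t ∈ K ↔ (T ∣ t ∧ 2 * T ≤ t) ∧ t < T * (k + 2) := fun t => by
    simp only [hK, Finset.mem_image, Finset.mem_range]
    constructor
    · rintro ⟨j, hj, rfl⟩
      exact ⟨⟨dvd_mul_right _ _, by nlinarith⟩, by gcongr⟩
    · rintro ⟨⟨⟨q, rfl⟩, h2⟩, h3⟩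
      have h3 := lt_of_mul_lt_mul_left h3 (Nat.zero_le T)
      rw [mul_comm 2 T] at h2
      have h2 := le_of_mul_le_mul_left h2 hT0
      exact ⟨q - 2, by omega, by rw [Nat.sub_add_cancel h2]⟩
  have hagree : ∀ t ≤ T * (k + 2), linNag κ ε t = linNag κ' ε t :=
    linNag_congr fun t ht => by
      simp only [hκ, hκ', hmem, ht, and_true]
  have hagree' : ∀ j ≤ k, linNag κ ε (T * (j + 2)) = linNag κ' ε (T * (j + 2)) := fun j hj =>
    hagree _ (by gcongr)
  have hend : ∀ t, T * (k + 2) ≤ t → θ ≤ |(linNag κ ε t).1| := fun t ht => by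
    refine (hk.trans ?_).trans (linNag_abs_le_of_forall_eq_zero (fun t ht => ?_) ?_ t ht)
    · rw [hagree' k le_rfl]
    · simp only [hκ]
      rw [if_neg fun h => ht.not_gt ((hmem t).1 h).2]
    · obtain ⟨ρ, hρ, -, he⟩ := (hper k).2
      rw [hagree' k le_rfl, he]
      nlinarith [mul_nonneg hρ (mul_self_nonneg (linNag κ' ε (T * (k + 2))).1)]
  refine ⟨k, K, κ, fun t => rfl, fun s hs => ((hmem s).1 hs).1.2, ?_, fun j hj => ?_, ?_, ?_⟩
  · rw [hK, Finset.sum_image fun i _ j _ hij => hinj hij]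
    rcases k with _ | n
    · simp; positivity
    -- The factor 23/20 bounds `1 + ρ`, as `h ≤ 1`; then `23 / 20 * (3 / 2) < 2`.
    calc ∑ j ∈ Finset.range (n + 1), |(linNag κ ε (T * (j + 2))).2|
        ≤ ∑ j ∈ Finset.range (n + 1), 23 / 20 * A j := by
          refine Finset.sum_le_sum fun j hj => ?_
          obtain ⟨ρ, hρ, hρ', he⟩ := (hper j).2
          rw [hagree' j (Finset.mem_range.1 hj).le, he, abs_mul, abs_of_nonneg (by linarith)]
          exact mul_le_mul_of_nonneg_right (by linarith) (abs_nonneg _)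
      _ ≤ 23 / 20 * (3 / 2 * A n) := by
          rw [← Finset.mul_sum]
          gcongr
          exact sum_range_succ_le_of_forall_three_mul_le (hA0 ▸ hε.le) hA3 n
      _ ≤ 2 * θ := by linarith [hmin n n.lt_succ_self]
  · rw [hagree' j hj]; exact hpow j
  -- If `k = 0` there are no kicks and already `θ ≤ ε`, so the bound holds at every time.
  · rintro t (ht | rfl)
    · exact hend t ht
    rcases le_total (T * (0 + 2)) t with ht | ht
    · exact hend t ht
    · rw [hagree t ht, hstart t (by linarith)]
      exact hk.trans (hA0.trans (abs_of_pos hε).symm).le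
  · exact fun hk0 => (hpow _).trans_lt (hmin _ (by omega))

/-! ### The lower bound -/

theorem mainTheorem1 :
    ∃ c₁ c₂ : ℝ, 0 < c₁ ∧ 0 < c₂ ∧
      ∀ ε G β η : ℝ, 0 < ε → 0 < G → 0 < β → 0 < η → η ≤ 1 / β →
        ∃ f : ℝ → ℝ,
          ConvexOn ℝ Set.univ f ∧
          IsSmooth β f ∧
          (∀ u v : ℝ, |f u - f v| ≤ G * |u - v|) ∧
          (∃ z : ℝ, ∀ u : ℝ, f z ≤ f u) ∧
          (∀ i : ℕ, 1 ≤ i → ∀ t : ℕ, t = ⌈10 / (η * β)⌉₊ * (i + 2) →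
            ((|nagX f η t 0 - nagX f η t ε| : ℝ) : EReal) ≤ initStability (nagX f η t) 0 ε ∧
            min (G / (3 * β)) (c₂ * Real.exp (c₁ * (η * β * (t : ℝ))) * ε) ≤
              |nagX f η t 0 - nagX f η t ε|) ∧
          (∀ t : ℕ,
            (⌈10 / (η * β)⌉₊ : ℝ) * (Real.log (3 * G / (2 * β * ε)) + 3) < (t : ℝ) →
            ((G / (3 * β) : ℝ) : EReal) ≤ initStability (nagX f η t) 0 ε) := by
  -- Rounding up gives `η * β * T ≤ 11`, so at `t = T * (i + 2)` the exponent is at most `i`, and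
  -- `exp i ≤ 3 ^ i`.
  refine ⟨1 / 11, Real.exp (-2), by norm_num, Real.exp_pos _, ?_⟩
  intro ε G β η hε hG hβ hη hηβ
  have h0 : 0 < η * β := mul_pos hη hβ
  have h1 : η * β ≤ 1 := (le_div_iff₀ hβ).1 hηβ
  set T := ⌈10 / (η * β)⌉₊
  have hT : 10 ≤ η * β * T := by
    have := (div_le_iff₀ h0).1 (Nat.le_ceil (10 / (η * β)))
    linarith
  have hT' : η * β * T ≤ 11 := by
    have h2 := (Nat.ceil_lt_add_one (by positivity : 0 ≤ 10 / (η * β))).le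
    have h3 := mul_le_mul_of_nonneg_left h2 h0.le
    rw [mul_add, mul_div_cancel₀ _ h0.ne'] at h3
    linarith
  obtain ⟨k, K, κ, hκ, hK, hsum, hgrow, hend, hklt⟩ :=
    -- With this threshold the ramps have total width at most `2G / (3β)`, within the Lipschitz
    -- budget.
    exists_linNag_growth hε h0 h1 hT (by positivity : 0 < G / (3 * β))
  obtain ⟨f, hconv, hsmooth, hlip, hmin, hdiff⟩ := exists_nag_sub_nag_eq_linNag (G := G) hβ hη K
    (fun s hs => by
      have h2 : (2 : ℝ) * T ≤ s := by exact_mod_cast hK s hs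
      have h3 := mul_le_mul_of_nonneg_left h2 h0.le
      have h4 : (1 : ℝ) < s := by nlinarith
      refine ⟨by exact_mod_cast h4, by linarith⟩) hκ (by
      calc β * ∑ s ∈ K, |(linNag κ ε s).2| ≤ β * (2 * (G / (3 * β))) := by gcongr
        _ = 2 / 3 * G := by field_simp
        _ ≤ G := by linarith)
  have habs : ∀ t, |nagX f η t 0 - nagX f η t ε| = |(linNag κ ε t).1| := fun t => by
    rw [abs_sub_comm, hdiff]
  have hstab : ∀ t, ((|nagX f η t 0 - nagX f η t ε| : ℝ) : EReal) ≤
      initStability (nagX f η t) 0 ε := fun t => by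
    rw [abs_sub_comm]
    exact le_iSup (fun x : {x : ℝ // ‖x - 0‖ ≤ ε} =>
      ((‖nagX f η t x - nagX f η t 0‖ : ℝ) : EReal)) ⟨ε, by simp [abs_of_pos hε]⟩
  refine ⟨f, hconv, hsmooth, hlip, hmin, fun i hi t ht => ⟨hstab t, ?_⟩, fun t ht => ?_⟩
  · rw [habs]
    rcases le_or_gt i k with hik | hik
    · refine (min_le_right _ _).trans ?_
      rw [ht]
      refine le_trans ?_ (hgrow i hik)
      gcongr
      rw [← Real.exp_add]
      calc Real.exp (-2 + 1 / 11 * (η * β * ((T * (i + 2) : ℕ) : ℝ))) ≤ Real.exp (i * 1) := by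
            have := mul_le_mul_of_nonneg_right hT' (by positivity : (0 : ℝ) ≤ i + 2)
            push_cast
            gcongr
            linarith
        _ = Real.exp 1 ^ i := Real.exp_nat_mul 1 i
        _ ≤ 3 ^ i := by gcongr; exact Real.exp_one_lt_three.le
    · refine (min_le_left _ _).trans (hend t (.inl ?_))
      rw [ht]
      gcongr
  · refine le_trans ?_ (hstab t)
    rw [habs, EReal.coe_le_coe_iff]
    refine hend t ?_
    rcases Nat.eq_zero_or_pos k with hk | hk
    · exact .inr hk
    left
    -- One kick before stopping the difference was below the threshold, so `k - 1` is at most the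
    -- logarithm and `T * (k + 2)` at most the stated time.
    have h2 : Real.exp ((k - 1 : ℕ) * 1) * ε ≤ G / (3 * β) := by
      refine le_trans ?_ (hklt hk).le
      rw [Real.exp_nat_mul]
      gcongr
      exact Real.exp_one_lt_three.le
    have h3 : Real.exp ((k - 1 : ℕ) * 1) ≤ 3 * G / (2 * β * ε) := by
      rw [le_div_iff₀ (by positivity)]
      rw [le_div_iff₀ (by positivity)] at h2
      nlinarith
    have h4 := (Real.le_log_iff_exp_le (by positivity)).2 h3
    rw [Nat.cast_sub hk] at h4
    have h5 : ((T * (k + 2) : ℕ) : ℝ) < t := by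
      refine lt_of_le_of_lt ?_ ht
      push_cast at h4 ⊢
      exact mul_le_mul_of_nonneg_left (by linarith) T.cast_nonneg
    exact_mod_cast h5.le
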